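/- **Theorem (Randomized Clustered Nyström Method).** For points $x_1,\dots,x_n\in\mathbb R^d$, an $m$-partition $\mathcal S=\{\mathcal S_1,\dots,\mathcal S_m\}$ is a partition of the index set $\{1,\dots,n\}$ into $m$ nonempty clusters, and $E(X,\mathcal S)=\sum_{i=1}^n\|x_i-\mu(x_i)\|_2^2$, where $\mu(x_i)$ is the mean of the points in the cluster containing $x_i$. There is an absolute constant $c>0$, and for every $\eta\in\mathbb R$, $\alpha\ge 1$ and $n\in\mathbb N$ there are constants $\eta_1,\eta_2>0$, depending only on $\eta,\alpha,n$, such that the following holds. Let $\kappa:\mathbb R^p\times\mathbb R^p\to\mathbb R$ be a symmetric positive semidefinite kernel with $$(\kappa(a,b)-\kappa(c',d))^2\le\eta\,(\|a-c'\|_2^2+\|b-d\|_2^2)\qquad\text{for all }a,b,c',d\in\mathbb R^p.$$ Let $X=[x_1,\dots,x_n]\in\mathbb R^{p\times n}$, let $K\in\mathbb R^{n\times n}$ have entries $K_{ij}=\kappa(x_i,x_j)$, and let $\mathcal S^{opt}$ be an $m$-partition minimizing $E(X,\cdot)$ over all $m$-partitions. Let $\varepsilon\in(0,1/3)$ and $p'\ge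 c\,m/\varepsilon^2$, and let $H\in\mathbb R^{p'\times p}$ be a random matrix with independent entries equal to $+1/\sqrt{p'}$ or $-1/\sqrt{p'}$ with probability $1/2$ each. Then, with probability at least $0.96$ over $H$, every $m$-partition $\widehat{\mathcal S}$ that is within the factor $\alpha$ of optimal for the sketched data $HX=[Hx_1,\dots,Hx_n]$, i.e. $E(HX,\widehat{\mathcal S})\le\alpha\min_{\mathcal S}E(HX,\mathcal S)$, satisfies $$E(X,\widehat{\mathcal S})\le\alpha(2+\varepsilon)E(X,\mathcal S^{opt})$$ and $$\|K-CW^\dagger C^T\|_F\le\eta_1\sqrt{(2+\varepsilon)E(X,\mathcal S^{opt})}+\eta_2(2+\varepsilon)E(X,\mathcal S^{opt}),$$ where $z_j=|\widehat{\mathcal S}_j|^{-1}\sum_{i\in\widehat{\mathcal S}_j}x_i$ $(j=1,\dots,m)$ are the landmark points, $C_{ij}=\kappa(x_i,z_j)$, $W_{ij}=\kappa(z_i,z_j)$, $W^\dagger$ is the Moore–Penrose pseudo-inverse of $W$, and $\|\cdot\|_F$ is the Frobenius norm. -/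

import Mathlib

open MeasureTheory ProbabilityTheory
open scoped Matrix Matrix.Norms.Frobenius

namespace ClusteredNystrom

/-- The Lipschitz-type condition
`(κ(a,b) - κ(c,d))² ≤ η (‖a - c‖² + ‖b - d‖²)` for all points of `ℝᵖ` (Euclidean norms). -/
def KernelLipschitz {p : ℕ}
    (κ : EuclideanSpace ℝ (Fin p) → EuclideanSpace ℝ (Fin p) → ℝ) (η : ℝ) : Prop :=
  ∀ a b c d : EuclideanSpace ℝ (Fin p),
    (κ a b - κ c d) ^ 2 ≤ η * (‖a - c‖ ^ 2 + ‖b - d‖ ^ 2)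

/-- The matrix `(κ(xᵢ, yⱼ))ᵢⱼ`. -/
def kernelMatrix {p n m : ℕ}
    (κ : EuclideanSpace ℝ (Fin p) → EuclideanSpace ℝ (Fin p) → ℝ)
    (x : Fin n → EuclideanSpace ℝ (Fin p)) (y : Fin m → EuclideanSpace ℝ (Fin p)) :
    Matrix (Fin n) (Fin m) ℝ :=
  Matrix.of fun i j => κ (x i) (y j)

/-- `κ` is a kernel function: symmetric and positive semidefinite (all its finite Gram matrices
are symmetric positive semidefinite). -/
def IsKernel {p : ℕ} (κ : EuclideanSpace ℝ (Fin p) → EuclideanSpace ℝ (Fin p) → ℝ) : Prop :=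
  ∀ (k : ℕ) (z : Fin k → EuclideanSpace ℝ (Fin p)), (kernelMatrix κ z z).PosSemidef

/-- The Moore-Penrose pseudo-inverse of a real symmetric matrix `A = U Λ Uᵀ`: invert the nonzero
eigenvalues and keep the zero ones (`0⁻¹ = 0` in Lean). -/
noncomputable def pinv {m : ℕ} (A : Matrix (Fin m) (Fin m) ℝ) (hA : A.IsHermitian) :
    Matrix (Fin m) (Fin m) ℝ :=
  (hA.eigenvectorUnitary : Matrix (Fin m) (Fin m) ℝ)
    * Matrix.diagonal (fun i => (hA.eigenvalues i)⁻¹)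
    * (hA.eigenvectorUnitary : Matrix (Fin m) (Fin m) ℝ)ᵀ

/-- The Nyström approximation error `‖K - C W† Cᵀ‖_F` for the data points `x` and the landmark
points `z`, where `K = κ(x, x)`, `C = κ(x, z)`, `W = κ(z, z)`. The norm is the Frobenius norm. -/
noncomputable def nystromError {p n m : ℕ}
    (κ : EuclideanSpace ℝ (Fin p) → EuclideanSpace ℝ (Fin p) → ℝ) (hκ : IsKernel κ)
    (x : Fin n → EuclideanSpace ℝ (Fin p)) (z : Fin m → EuclideanSpace ℝ (Fin p)) : ℝ :=
  ‖kernelMatrix κ x x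
    - kernelMatrix κ x z * pinv (kernelMatrix κ z z) (hκ m z).isHermitian * (kernelMatrix κ x z)ᵀ‖

/-- An `m`-partition of `n` data points, given by the map that sends (the index of) a point to (the
index of) its cluster: the clusters are disjoint, cover the data, and surjectivity says that
none of them is empty. -/
def IsPartition {n m : ℕ} (S : Fin n → Fin m) : Prop :=
  Function.Surjective S

/-- The sample mean of the `j`-th cluster of the data points `x` under the assignment `S`. -/
noncomputable def clusterMean {d n m : ℕ} (x : Fin n → EuclideanSpace ℝ (Fin d))
    (S : Fin n → Fin m) (j : Fin m) : EuclideanSpace ℝ (Fin d) :=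
  ((Finset.univ.filter fun i => S i = j).card : ℝ)⁻¹ •
    ∑ i ∈ Finset.univ.filter (fun i => S i = j), x i

/-- The K-means objective `E(X, S) = ∑ᵢ ‖xᵢ - μ(xᵢ)‖²`, where `μ(xᵢ)` is the mean of the cluster
of `xᵢ`. -/
noncomputable def kmeansCost {d n m : ℕ} (x : Fin n → EuclideanSpace ℝ (Fin d))
    (S : Fin n → Fin m) : ℝ :=
  ∑ i, ‖x i - clusterMean x S (S i)‖ ^ 2

/-- `S` is an `m`-partition whose K-means objective is within the factor `α` of the optimal one. -/
def IsNearOptimal {d n m : ℕ} (α : ℝ) (x : Fin n → EuclideanSpace ℝ (Fin d))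
    (S : Fin n → Fin m) : Prop :=
  IsPartition S ∧ ∀ T : Fin n → Fin m, IsPartition T → kmeansCost x S ≤ α * kmeansCost x T

/-- `S` is an optimal `m`-partition for the K-means objective. -/
def IsOptimal {d n m : ℕ} (x : Fin n → EuclideanSpace ℝ (Fin d)) (S : Fin n → Fin m) : Prop :=
  IsPartition S ∧ ∀ T : Fin n → Fin m, IsPartition T → kmeansCost x S ≤ kmeansCost x T

/-- The sketches `H xᵢ`, i.e. the columns of `H X`. -/
noncomputable def sketch {q p n : ℕ} (H : Matrix (Fin q) (Fin p) ℝ)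
    (x : Fin n → EuclideanSpace ℝ (Fin p)) : Fin n → EuclideanSpace ℝ (Fin q) :=
  fun i => WithLp.toLp 2 (H *ᵥ (x i).ofLp)

/-- `H` is a random `q × p` sign matrix: its entries are independent random variables, each equal
to `1/√q` or `-1/√q` with probability `1/2`. -/
structure IsRandomSignMatrix {Ω : Type*} [MeasurableSpace Ω] (μ : Measure Ω) {q p : ℕ}
    (H : Ω → Matrix (Fin q) (Fin p) ℝ) : Prop where
  measurable_entry : ∀ i j, Measurable fun ω => H ω i j
  prob_pos : ∀ i j, μ {ω | H ω i j = 1 / √(q : ℝ)} = 1 / 2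
  prob_neg : ∀ i j, μ {ω | H ω i j = -(1 / √(q : ℝ))} = 1 / 2
  indep : iIndepFun (fun (e : Fin q × Fin p) ω => H ω e.1 e.2) μ

end ClusteredNystrom

namespace ClusteredNystrom

section Nystrom

variable {m : ℕ} {A : Matrix (Fin m) (Fin m) ℝ}

theorem eigenvectorUnitary_transpose_mul_self (hA : A.IsHermitian) :
    (hA.eigenvectorUnitary : Matrix (Fin m) (Fin m) ℝ)ᵀ *
      (hA.eigenvectorUnitary : Matrix (Fin m) (Fin m) ℝ) = 1 := by
  have h := Unitary.coe_star_mul_self hA.eigenvectorUnitary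
  rwa [Matrix.star_eq_conjTranspose, Matrix.conjTranspose_eq_transpose_of_trivial] at h

theorem eq_eigenvectorUnitary_mul_diagonal (hA : A.IsHermitian) :
    A = (hA.eigenvectorUnitary : Matrix (Fin m) (Fin m) ℝ) * Matrix.diagonal hA.eigenvalues *
      (hA.eigenvectorUnitary : Matrix (Fin m) (Fin m) ℝ)ᵀ := by
  have h := hA.spectral_theorem
  rw [Unitary.conjStarAlgAut_apply, Matrix.star_eq_conjTranspose,
    Matrix.conjTranspose_eq_transpose_of_trivial] at h
  exact h

theorem conj_diagonal_mul_conj_diagonal {U : Matrix (Fin m) (Fin m) ℝ} (hU : Uᵀ * U = 1)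
    (a b : Fin m → ℝ) :
    (U * Matrix.diagonal a * Uᵀ) * (U * Matrix.diagonal b * Uᵀ)
      = U * Matrix.diagonal (fun i => a i * b i) * Uᵀ := by
  calc (U * Matrix.diagonal a * Uᵀ) * (U * Matrix.diagonal b * Uᵀ)
      = U * Matrix.diagonal a * (Uᵀ * U) * Matrix.diagonal b * Uᵀ := by simp only [Matrix.mul_assoc]
    _ = U * (Matrix.diagonal a * Matrix.diagonal b) * Uᵀ := by
        rw [hU, Matrix.mul_one]; simp only [Matrix.mul_assoc]
    _ = _ := by rw [Matrix.diagonal_mul_diagonal]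

theorem pinv_transpose (hA : A.IsHermitian) : (pinv A hA)ᵀ = pinv A hA := by
  simp [pinv, Matrix.transpose_mul, Matrix.mul_assoc]

theorem mul_pinv_mul_self (hA : A.IsHermitian) : A * pinv A hA * A = A := by
  have hU := eigenvectorUnitary_transpose_mul_self hA
  have h := eq_eigenvectorUnitary_mul_diagonal hA
  set U := (hA.eigenvectorUnitary : Matrix (Fin m) (Fin m) ℝ)
  have hp : pinv A hA = U * Matrix.diagonal (fun i => (hA.eigenvalues i)⁻¹) * Uᵀ := rfl
  rw [hp]
  calc A * (U * Matrix.diagonal (fun i => (hA.eigenvalues i)⁻¹) * Uᵀ) * A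
      = (U * Matrix.diagonal hA.eigenvalues * Uᵀ) *
        (U * Matrix.diagonal (fun i => (hA.eigenvalues i)⁻¹) * Uᵀ) *
        (U * Matrix.diagonal hA.eigenvalues * Uᵀ) := by rw [← h]
    _ = U * Matrix.diagonal hA.eigenvalues * Uᵀ := by
        rw [conj_diagonal_mul_conj_diagonal hU, conj_diagonal_mul_conj_diagonal hU]
        congr 3
        ext i
        exact mul_inv_mul_cancel _
    _ = A := h.symm

theorem pinv_mul_mul_pinv (hA : A.IsHermitian) : pinv A hA * A * pinv A hA = pinv A hA := by
  have hU := eigenvectorUnitary_transpose_mul_self hA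
  have h := eq_eigenvectorUnitary_mul_diagonal hA
  set U := (hA.eigenvectorUnitary : Matrix (Fin m) (Fin m) ℝ)
  have hp : pinv A hA = U * Matrix.diagonal (fun i => (hA.eigenvalues i)⁻¹) * Uᵀ := rfl
  rw [hp]
  calc (U * Matrix.diagonal (fun i => (hA.eigenvalues i)⁻¹) * Uᵀ) * A *
        (U * Matrix.diagonal (fun i => (hA.eigenvalues i)⁻¹) * Uᵀ)
      = (U * Matrix.diagonal (fun i => (hA.eigenvalues i)⁻¹) * Uᵀ) *
        (U * Matrix.diagonal hA.eigenvalues * Uᵀ) *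
        (U * Matrix.diagonal (fun i => (hA.eigenvalues i)⁻¹) * Uᵀ) := by rw [← h]
    _ = _ := by
        rw [conj_diagonal_mul_conj_diagonal hU, conj_diagonal_mul_conj_diagonal hU]
        congr 3
        ext i
        rcases eq_or_ne (hA.eigenvalues i) 0 with h0 | h0
        · simp [h0]
        · field_simp

theorem mul_pinv_gram_mul_gram {k : ℕ} (Z : Matrix (Fin k) (Fin m) ℝ) (hA : A.IsHermitian)
    (hAZ : A = Zᵀ * Z) : Z * pinv A hA * A = Z := by
  subst hAZ
  set Q := pinv (Zᵀ * Z) hA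
  have h1 : (Zᵀ * Z) * Q * (Zᵀ * Z) = Zᵀ * Z := mul_pinv_mul_self hA
  have h2 : Qᵀ = Q := pinv_transpose hA
  have key : (Z * Q * (Zᵀ * Z) - Z)ᴴ * (Z * Q * (Zᵀ * Z) - Z) = 0 := by
    rw [Matrix.conjTranspose_eq_transpose_of_trivial]
    have : (Z * Q * (Zᵀ * Z) - Z)ᵀ * (Z * Q * (Zᵀ * Z) - Z)
        = ((Zᵀ * Z) * Q) * ((Zᵀ * Z) * Q * (Zᵀ * Z)) - ((Zᵀ * Z) * Q * (Zᵀ * Z))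
          - ((Zᵀ * Z) * Q * (Zᵀ * Z)) + Zᵀ * Z := by
      simp only [Matrix.transpose_sub, Matrix.transpose_mul, Matrix.transpose_transpose, h2,
        Matrix.sub_mul, Matrix.mul_sub, Matrix.mul_assoc]
      abel
    rw [this, h1, h1]
    abel
  exact sub_eq_zero.mp (Matrix.conjTranspose_mul_self_eq_zero.mp key)

theorem frobenius_norm_gram_le_trace {k n : ℕ} (B : Matrix (Fin k) (Fin n) ℝ) :
    ‖Bᵀ * B‖ ≤ (Bᵀ * B).trace := by
  have h1 : ‖Bᵀ * B‖ ≤ ‖Bᵀ‖ * ‖B‖ := Matrix.frobenius_norm_mul _ _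
  rw [Matrix.frobenius_norm_transpose] at h1
  refine h1.trans (le_of_eq ?_)
  rw [← pow_two, Matrix.frobenius_norm_def, ← Real.sqrt_eq_rpow, Real.sq_sqrt (by positivity)]
  simp only [Matrix.trace, Matrix.diag, Matrix.mul_apply, Matrix.transpose_apply]
  rw [Finset.sum_comm]
  simp [pow_two]

theorem exists_gram_of_isKernel {p n m : ℕ}
    {κ : EuclideanSpace ℝ (Fin p) → EuclideanSpace ℝ (Fin p) → ℝ} (hκ : IsKernel κ)
    (x : Fin n → EuclideanSpace ℝ (Fin p)) (z : Fin m → EuclideanSpace ℝ (Fin p)) :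
    ∃ (k : ℕ) (B : Matrix (Fin k) (Fin n) ℝ) (Z : Matrix (Fin k) (Fin m) ℝ),
      kernelMatrix κ x x = Bᵀ * B ∧ kernelMatrix κ x z = Bᵀ * Z ∧ kernelMatrix κ z z = Zᵀ * Z := by
  obtain ⟨k, v, hv⟩ := Matrix.posSemidef_iff_eq_sum_vecMulVec.mp (hκ (n + m) (Fin.append x z))
  have h : ∀ i j, κ (Fin.append x z i) (Fin.append x z j) = ∑ l, v l i * v l j := by
    intro i j
    have := congrFun (congrFun hv i) j
    simpa [kernelMatrix, Matrix.sum_apply, Matrix.vecMulVec_apply] using this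
  refine ⟨k, Matrix.of fun l i => v l (Fin.castAdd m i), Matrix.of fun l j => v l (Fin.natAdd n j),
    ?_, ?_, ?_⟩
  · ext i j
    simpa [kernelMatrix, Matrix.mul_apply] using h (Fin.castAdd m i) (Fin.castAdd m j)
  · ext i j
    simpa [kernelMatrix, Matrix.mul_apply] using h (Fin.castAdd m i) (Fin.natAdd n j)
  · ext i j
    simpa [kernelMatrix, Matrix.mul_apply] using h (Fin.natAdd n i) (Fin.natAdd n j)

/-- The Nyström error is at most the squared distance, in feature space, from the data points to
assigned landmark points. -/
theorem nystromError_le_sum {p n m : ℕ}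
    {κ : EuclideanSpace ℝ (Fin p) → EuclideanSpace ℝ (Fin p) → ℝ} (hκ : IsKernel κ)
    (x : Fin n → EuclideanSpace ℝ (Fin p)) (z : Fin m → EuclideanSpace ℝ (Fin p))
    (S : Fin n → Fin m) :
    nystromError κ hκ x z
      ≤ ∑ i, (κ (x i) (x i) - 2 * κ (x i) (z (S i)) + κ (z (S i)) (z (S i))) := by
  obtain ⟨_, B, Z, hK, hC, hW⟩ := exists_gram_of_isKernel hκ x z
  have hPSD := hκ m z
  have hH := hPSD.isHermitian
  rw [nystromError]
  set W := kernelMatrix κ z z with hWdef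
  set C := kernelMatrix κ x z with hCdef
  set Q := pinv W hH with hQ
  have hQT : Qᵀ = Q := pinv_transpose hH
  have hQWQ : Q * W * Q = Q := pinv_mul_mul_pinv hH
  have hZ : Z * Q * W = Z := mul_pinv_gram_mul_gram Z hH hW
  have hWT : Wᵀ = W := by
    rw [hW, Matrix.transpose_mul, Matrix.transpose_transpose]
  have hCQW : C * Q * W = C := by
    rw [hC, Matrix.mul_assoc, Matrix.mul_assoc, ← Matrix.mul_assoc Z, hZ]
  have hWQC : W * Q * Cᵀ = Cᵀ := by
    have := congrArg Matrix.transpose hCQW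
    simpa only [Matrix.transpose_mul, hQT, hWT, Matrix.mul_assoc] using this
  have hR : kernelMatrix κ x x - C * Q * Cᵀ
      = (B - Z * Q * Cᵀ)ᵀ * (B - Z * Q * Cᵀ) := by
    have h1 : (B - Z * Q * Cᵀ)ᵀ * (B - Z * Q * Cᵀ)
        = Bᵀ * B - (Bᵀ * Z) * Q * Cᵀ - C * Q * (Bᵀ * Z)ᵀ + C * (Q * (Zᵀ * Z) * Q) * Cᵀ := by
      simp only [Matrix.transpose_sub, Matrix.transpose_mul, Matrix.transpose_transpose, hQT,
        Matrix.sub_mul, Matrix.mul_sub, Matrix.mul_assoc]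
      abel
    rw [h1, ← hC, ← hW, hQWQ, hK]
    abel
  rw [hR]
  refine (frobenius_norm_gram_le_trace _).trans ?_
  rw [← hR]
  let T : Matrix (Fin m) (Fin n) ℝ := Matrix.of fun j i => if S i = j then 1 else 0
  have hT : (Q * Cᵀ - T)ᴴ * W * (Q * Cᵀ - T) = C * Q * Cᵀ - C * T - (C * T)ᵀ + Tᵀ * W * T := by
    rw [Matrix.conjTranspose_eq_transpose_of_trivial]
    have h1 : (Q * Cᵀ - T)ᵀ * W * (Q * Cᵀ - T)
        = C * (Q * W * Q) * Cᵀ - (C * Q * W) * T - Tᵀ * (W * Q * Cᵀ) + Tᵀ * W * T := by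
      simp only [Matrix.transpose_sub, Matrix.transpose_mul, Matrix.transpose_transpose, hQT,
        Matrix.sub_mul, Matrix.mul_sub, Matrix.mul_assoc]
      abel
    rw [h1, hQWQ, hCQW, hWQC, Matrix.transpose_mul]
  have hpos := hPSD.conjTranspose_mul_mul_same (Q * Cᵀ - T)
  rw [hT] at hpos
  simp only [Matrix.trace, Matrix.diag]
  refine Finset.sum_le_sum fun i _ => ?_
  have hii := hpos.diag_nonneg (i := i)
  have hCT : (C * T) i i = κ (x i) (z (S i)) := by
    simp [Matrix.mul_apply, T, hCdef, kernelMatrix]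
  have hTWT : (Tᵀ * W * T) i i = κ (z (S i)) (z (S i)) := by
    simp [Matrix.mul_apply, T, hWdef, kernelMatrix]
  simp only [Matrix.add_apply, Matrix.sub_apply, Matrix.transpose_apply, hCT, hTWT] at hii
  have hKii : kernelMatrix κ x x i i = κ (x i) (x i) := rfl
  rw [Matrix.sub_apply, hKii]
  linarith

theorem KernelLipschitz.abs_sub_le {p : ℕ}
    {κ : EuclideanSpace ℝ (Fin p) → EuclideanSpace ℝ (Fin p) → ℝ} {η : ℝ}
    (h : KernelLipschitz κ η) (a b c : EuclideanSpace ℝ (Fin p)) :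
    |κ a b - κ a c| ≤ √(η * ‖b - c‖ ^ 2) := by
  refine Real.abs_le_sqrt ?_
  simpa using h a b a c

theorem IsKernel.symm {p : ℕ}
    {κ : EuclideanSpace ℝ (Fin p) → EuclideanSpace ℝ (Fin p) → ℝ} (hκ : IsKernel κ)
    (a b : EuclideanSpace ℝ (Fin p)) : κ a b = κ b a := by
  have h := (hκ 2 ![a, b]).isHermitian.apply 1 0
  simpa [kernelMatrix] using h

theorem nystromError_le_sqrt {p n m : ℕ}
    {κ : EuclideanSpace ℝ (Fin p) → EuclideanSpace ℝ (Fin p) → ℝ} (hκ : IsKernel κ) {η : ℝ}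
    (hη : KernelLipschitz κ η)
    (x : Fin n → EuclideanSpace ℝ (Fin p)) (z : Fin m → EuclideanSpace ℝ (Fin p))
    (S : Fin n → Fin m) :
    nystromError κ hκ x z ≤ 2 * √(n * |η|) * √(∑ i, ‖x i - z (S i)‖ ^ 2) := by
  refine (nystromError_le_sum hκ x z S).trans ?_
  have h1 : ∀ i, κ (x i) (x i) - 2 * κ (x i) (z (S i)) + κ (z (S i)) (z (S i))
      ≤ 2 * √|η| * ‖x i - z (S i)‖ := by
    intro i
    have hb : √(η * ‖x i - z (S i)‖ ^ 2) ≤ √|η| * ‖x i - z (S i)‖ := by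
      rw [← Real.sqrt_sq (norm_nonneg (x i - z (S i))), ← Real.sqrt_mul (abs_nonneg _),
        Real.sqrt_sq (norm_nonneg _)]
      exact Real.sqrt_le_sqrt (mul_le_mul_of_nonneg_right (le_abs_self _) (by positivity))
    have ha := (abs_le.mp ((hη.abs_sub_le (x i) (x i) (z (S i))).trans hb)).2
    have hc := (abs_le.mp ((hη.abs_sub_le (z (S i)) (x i) (z (S i))).trans hb)).1
    rw [hκ.symm (z (S i)) (x i)] at hc
    linarith
  refine (Finset.sum_le_sum fun i _ => h1 i).trans ?_
  rw [← Finset.mul_sum, Real.sqrt_mul (Nat.cast_nonneg n)]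
  have h2 : ∑ i, ‖x i - z (S i)‖ ≤ √n * √(∑ i, ‖x i - z (S i)‖ ^ 2) := by
    rw [← Real.sqrt_mul (Nat.cast_nonneg n)]
    refine Real.le_sqrt_of_sq_le ?_
    have := sq_sum_le_card_mul_sum_sq (s := (Finset.univ : Finset (Fin n)))
      (f := fun i => ‖x i - z (S i)‖)
    simpa using this
  calc 2 * √|η| * ∑ i, ‖x i - z (S i)‖
      ≤ 2 * √|η| * (√n * √(∑ i, ‖x i - z (S i)‖ ^ 2)) := by gcongr
    _ = _ := by ring

end Nystrom

section KMeans

open scoped InnerProductSpace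

theorem sum_norm_sq_sub_mean_le {V : Type*} [NormedAddCommGroup V] [InnerProductSpace ℝ V]
    {n m : ℕ} (x : Fin n → V) (S : Fin n → Fin m) (μ c : Fin m → V)
    (h : ∀ j, ∑ i with S i = j, (x i - μ j) = 0) :
    ∑ i, ‖x i - μ (S i)‖ ^ 2 ≤ ∑ i, ‖x i - c (S i)‖ ^ 2 := by
  have hcross : ∑ i, ⟪x i - μ (S i), μ (S i) - c (S i)⟫_ℝ = 0 := by
    rw [← Finset.sum_fiberwise (s := Finset.univ) (g := S)]
    refine Finset.sum_eq_zero fun j _ => ?_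
    calc ∑ i with S i = j, ⟪x i - μ (S i), μ (S i) - c (S i)⟫_ℝ
        = ∑ i with S i = j, ⟪x i - μ j, μ j - c j⟫_ℝ := by
          refine Finset.sum_congr rfl fun i hi => ?_
          rw [(Finset.mem_filter.mp hi).2]
      _ = 0 := by rw [← sum_inner, h j, inner_zero_left]
  have hexp : ∀ i, ‖x i - c (S i)‖ ^ 2 = ‖x i - μ (S i)‖ ^ 2
      + 2 * ⟪x i - μ (S i), μ (S i) - c (S i)⟫_ℝ + ‖μ (S i) - c (S i)‖ ^ 2 := by
    intro i
    rw [← norm_add_sq_real, sub_add_sub_cancel]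
  simp only [hexp, Finset.sum_add_distrib, ← Finset.mul_sum, hcross]
  have : 0 ≤ ∑ i, ‖μ (S i) - c (S i)‖ ^ 2 := by positivity
  linarith

variable {p q n m : ℕ}

theorem sum_sub_clusterMean (x : Fin n → EuclideanSpace ℝ (Fin p)) (S : Fin n → Fin m)
    (j : Fin m) : ∑ i with S i = j, (x i - clusterMean x S j) = 0 := by
  rw [Finset.sum_sub_distrib, Finset.sum_const, clusterMean, ← Nat.cast_smul_eq_nsmul ℝ, smul_smul]
  rcases Finset.eq_empty_or_nonempty (Finset.univ.filter fun i => S i = j) with h | h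
  · simp [h]
  · have : ((Finset.univ.filter fun i => S i = j).card : ℝ) ≠ 0 := by
      exact_mod_cast h.card_pos.ne'
    rw [mul_inv_cancel₀ this, one_smul, sub_self]

theorem clusterMean_map (L : EuclideanSpace ℝ (Fin p) →ₗ[ℝ] EuclideanSpace ℝ (Fin q))
    (x : Fin n → EuclideanSpace ℝ (Fin p)) (S : Fin n → Fin m) (j : Fin m) :
    clusterMean (fun i => L (x i)) S j = L (clusterMean x S j) := by
  simp [clusterMean]

theorem kmeansCost_map (L : EuclideanSpace ℝ (Fin p) →ₗ[ℝ] EuclideanSpace ℝ (Fin q))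
    (x : Fin n → EuclideanSpace ℝ (Fin p)) (S : Fin n → Fin m) :
    kmeansCost (fun i => L (x i)) S = ∑ i, ‖L (x i - clusterMean x S (S i))‖ ^ 2 := by
  simp [kmeansCost, clusterMean_map]

/-- Centering the clusters does not increase the sum of squares of a linear image. -/
theorem sum_norm_sq_map_sub_clusterMean_le {V : Type*} [NormedAddCommGroup V]
    [InnerProductSpace ℝ V] (g : EuclideanSpace ℝ (Fin p) →ₗ[ℝ] V)
    (x : Fin n → EuclideanSpace ℝ (Fin p)) (S : Fin n → Fin m) :
    ∑ i, ‖g (x i - clusterMean x S (S i))‖ ^ 2 ≤ ∑ i, ‖g (x i)‖ ^ 2 := by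
  have h := sum_norm_sq_sub_mean_le (fun i => g (x i)) S (fun j => g (clusterMean x S j)) 0
    (fun j => by
      simp only [← map_sub, ← map_sum, sum_sub_clusterMean, map_zero])
  simpa using h

theorem norm_sub_starProjection_le (U : Submodule ℝ (EuclideanSpace ℝ (Fin p)))
    (v : EuclideanSpace ℝ (Fin p)) {u : EuclideanSpace ℝ (Fin p)} (hu : u ∈ U) :
    ‖v - U.starProjection v‖ ≤ ‖v - u‖ := by
  rw [Submodule.starProjection_minimal]
  exact ciInf_le ⟨0, by rintro _ ⟨y, rfl⟩; exact norm_nonneg _⟩ (⟨u, hu⟩ : U)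

/-- A linear map that nearly preserves the norm from below on a subspace `U` containing the optimal
cluster means, nearly preserves orthogonality between `U` and the residuals of the data, and does
not increase the optimal cost by much, also preserves near-optimality of partitions up to a factor
of about two. -/
theorem kmeansCost_le_of_sketch {ι : Type*} [Fintype ι]
    (L : EuclideanSpace ℝ (Fin p) →ₗ[ℝ] EuclideanSpace ℝ (Fin q))
    (x : Fin n → EuclideanSpace ℝ (Fin p)) (Sopt S : Fin n → Fin m)
    (U : Submodule ℝ (EuclideanSpace ℝ (Fin p))) (e : OrthonormalBasis ι ℝ U)
    (hU : ∀ j, clusterMean x Sopt j ∈ U) {α ε : ℝ} (hα : 1 ≤ α) (hε : 0 < ε) (hε' : ε < 1 / 3)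
    (hlow : ∀ u ∈ U, (1 - ε / 12) * ‖u‖ ^ 2 ≤ ‖L u‖ ^ 2)
    (hcross : ∑ i, ∑ l, ⟪L (e l : EuclideanSpace ℝ (Fin p)), L (x i - U.starProjection (x i))⟫_ℝ ^ 2
      ≤ (ε / 12) ^ 2 * ∑ i, ‖x i - U.starProjection (x i)‖ ^ 2)
    (hopt : kmeansCost (fun i => L (x i)) Sopt ≤ (1 + ε / 12) * kmeansCost x Sopt)
    (hS : kmeansCost (fun i => L (x i)) S ≤ α * kmeansCost (fun i => L (x i)) Sopt) :
    kmeansCost x S ≤ α * ((2 + ε) * kmeansCost x Sopt) := by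
  set δ := ε / 12 with hδ
  have hδ0 : 0 < δ := by positivity
  set P := U.starProjection with hP
  set y : Fin n → EuclideanSpace ℝ (Fin p) := fun i => x i - clusterMean x S (S i) with hy
  set a := ∑ i, ‖P (y i)‖ ^ 2 with ha
  set b := ∑ i, ‖y i - P (y i)‖ ^ 2 with hb
  set W := ∑ i, ‖x i - P (x i)‖ ^ 2 with hW
  have ha0 : 0 ≤ a := by positivity
  have hbW : b ≤ W := by
    have := sum_norm_sq_map_sub_clusterMean_le
      (LinearMap.id - (P : EuclideanSpace ℝ (Fin p) →ₗ[ℝ] EuclideanSpace ℝ (Fin p))) x S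
    simpa [-map_sub] using this
  have hWopt : W ≤ kmeansCost x Sopt := by
    refine Finset.sum_le_sum fun i _ => ?_
    gcongr
    exact norm_sub_starProjection_le U _ (hU _)
  have hpyth : ∀ v, ‖v‖ ^ 2 = ‖P v‖ ^ 2 + ‖v - P v‖ ^ 2 := by
    intro v
    have h0 : ⟪P v, v - P v⟫_ℝ = 0 :=
      Submodule.sub_starProjection_mem_orthogonal v _ (Submodule.starProjection_apply_mem U v)
    have h1 := norm_add_sq_real (P v) (v - P v)
    rw [add_sub_cancel, h0] at h1
    linarith
  have hcost : kmeansCost x S = a + b := by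
    rw [ha, hb, ← Finset.sum_add_distrib]
    exact Finset.sum_congr rfl fun i _ => hpyth _
  have hPsum : ∀ v, P v = ∑ l, ⟪(e l : EuclideanSpace ℝ (Fin p)), v⟫_ℝ •
      (e l : EuclideanSpace ℝ (Fin p)) := by
    intro v
    rw [hP, e.starProjection_eq_sum_rankOne]
    simp
  have hPnorm : ∀ v, ‖P v‖ ^ 2 = ∑ l, ⟪(e l : EuclideanSpace ℝ (Fin p)), v⟫_ℝ ^ 2 := by
    intro v
    have h0 : ⟪P v, v - P v⟫_ℝ = 0 :=
      Submodule.sub_starProjection_mem_orthogonal v _ (Submodule.starProjection_apply_mem U v)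
    rw [inner_sub_right, real_inner_self_eq_norm_sq, sub_eq_zero] at h0
    rw [← h0, hPsum v, sum_inner]
    simp only [real_inner_smul_left, pow_two]
  have hterm : ∀ i, (1 - δ) * ‖P (y i)‖ ^ 2 - δ * ‖P (y i)‖ ^ 2
      - δ⁻¹ * ∑ l, ⟪L (e l : EuclideanSpace ℝ (Fin p)), L (y i - P (y i))⟫_ℝ ^ 2
      ≤ ‖L (y i)‖ ^ 2 := by
    intro i
    have h1 := norm_add_sq_real (L (P (y i))) (L (y i - P (y i)))
    rw [← map_add, add_sub_cancel] at h1
    have h2 := hlow _ (Submodule.starProjection_apply_mem U (y i))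
    have h3 : -(δ * ‖P (y i)‖ ^ 2)
        - δ⁻¹ * ∑ l, ⟪L (e l : EuclideanSpace ℝ (Fin p)), L (y i - P (y i))⟫_ℝ ^ 2
        ≤ 2 * ⟪L (P (y i)), L (y i - P (y i))⟫_ℝ := by
      have h4 : ⟪L (P (y i)), L (y i - P (y i))⟫_ℝ
          = ∑ l, ⟪(e l : EuclideanSpace ℝ (Fin p)), y i⟫_ℝ *
            ⟪L (e l : EuclideanSpace ℝ (Fin p)), L (y i - P (y i))⟫_ℝ := by
        generalize L (y i - P (y i)) = r
        rw [hPsum (y i), map_sum, sum_inner]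
        simp only [map_smul, real_inner_smul_left]
      rw [h4, hPnorm, Finset.mul_sum, Finset.mul_sum, Finset.mul_sum, ← Finset.sum_neg_distrib,
        ← Finset.sum_sub_distrib]
      refine Finset.sum_le_sum fun l _ => ?_
      generalize ⟪(e l : EuclideanSpace ℝ (Fin p)), y i⟫_ℝ = s
      generalize ⟪L (e l : EuclideanSpace ℝ (Fin p)), L (y i - P (y i))⟫_ℝ = t
      have : 0 ≤ δ⁻¹ * (δ * s + t) ^ 2 := by positivity
      have e1 : δ⁻¹ * (δ * s + t) ^ 2 = δ * s ^ 2 + 2 * (s * t) + δ⁻¹ * t ^ 2 := by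
        field_simp
        ring
      linarith
    have h5 : 0 ≤ ‖L (y i - P (y i))‖ ^ 2 := by positivity
    linarith
  have hcross' : ∑ i, ∑ l, ⟪L (e l : EuclideanSpace ℝ (Fin p)), L (y i - P (y i))⟫_ℝ ^ 2
      ≤ δ ^ 2 * W := by
    refine le_trans ?_ hcross
    rw [Finset.sum_comm, Finset.sum_comm (s := Finset.univ) (t := Finset.univ)
      (f := fun i l => ⟪L (e l : EuclideanSpace ℝ (Fin p)), L (x i - P (x i))⟫_ℝ ^ 2)]
    refine Finset.sum_le_sum fun l _ => ?_
    have := sum_norm_sq_map_sub_clusterMean_le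
      ((innerₛₗ ℝ (L (e l : EuclideanSpace ℝ (Fin p)))) ∘ₗ L ∘ₗ
        (LinearMap.id - (P : EuclideanSpace ℝ (Fin p) →ₗ[ℝ] EuclideanSpace ℝ (Fin p)))) x S
    simpa [-map_sub] using this
  have hsum : (1 - 2 * δ) * a - δ * W ≤ kmeansCost (fun i => L (x i)) S := by
    rw [kmeansCost_map]
    refine le_trans ?_ (Finset.sum_le_sum fun i _ => hterm i)
    rw [Finset.sum_sub_distrib, Finset.sum_sub_distrib, ← Finset.mul_sum, ← Finset.mul_sum,
      ← Finset.mul_sum]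
    have : δ⁻¹ * (∑ i, ∑ l, ⟪L (e l : EuclideanSpace ℝ (Fin p)), L (y i - P (y i))⟫_ℝ ^ 2)
        ≤ δ⁻¹ * (δ ^ 2 * W) := by gcongr
    have e1 : δ⁻¹ * (δ ^ 2 * W) = δ * W := by field_simp
    rw [e1] at this
    linarith
  set O := kmeansCost x Sopt with hO
  have hO0 : 0 ≤ O := by rw [hO, kmeansCost]; positivity
  have hαO : O ≤ α * O := le_mul_of_one_le_left hO0 hα
  have h1 : (1 - 2 * δ) * a ≤ (1 + 2 * δ) * (α * O) := by
    have : α * kmeansCost (fun i => L (x i)) Sopt ≤ α * ((1 + δ) * O) := by gcongr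
    nlinarith
  have h2 : a ≤ (1 + ε) * (α * O) := by
    have h3 : (1 + 2 * δ) * (α * O) ≤ (1 - 2 * δ) * ((1 + ε) * (α * O)) := by
      have : (1 + 2 * δ) ≤ (1 - 2 * δ) * (1 + ε) := by rw [hδ]; nlinarith
      nlinarith
    have h4 : 0 < 1 - 2 * δ := by rw [hδ]; linarith
    exact le_of_mul_le_mul_left (h1.trans h3) h4
  rw [hcost]
  linarith

end KMeans

section Net

variable {V F : Type*} [NormedAddCommGroup V] [InnerProductSpace ℝ V] [FiniteDimensional ℝ V]
  [NormedAddCommGroup F] [InnerProductSpace ℝ F]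

variable (V) in
theorem exists_net_unit_sphere :
    ∃ N : Finset V, N.card ≤ 5 ^ Module.finrank ℝ V ∧ (∀ y ∈ N, ‖y‖ = 1) ∧
      ∀ u : V, ‖u‖ = 1 → ∃ y ∈ N, ‖u - y‖ ≤ 1 / 2 := by
  classical
  let good : Finset V → Prop := fun s =>
    (∀ c ∈ s, ‖c‖ = 2) ∧ ∀ c ∈ s, ∀ d ∈ s, c ≠ d → 1 ≤ ‖c - d‖
  have hbound : ∀ s, good s → s.card ≤ 5 ^ Module.finrank ℝ V := fun s hs =>
    Besicovitch.card_le_of_separated s (fun c hc => (hs.1 c hc).le) hs.2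
  have hmax : ∃ s, good s ∧ ∀ t, good t → t.card ≤ s.card := by
    have hne : {k | ∃ s, good s ∧ s.card = k}.Nonempty := ⟨0, ∅, ⟨by simp, by simp⟩, rfl⟩
    have hbdd : BddAbove {k | ∃ s, good s ∧ s.card = k} :=
      ⟨5 ^ Module.finrank ℝ V, by rintro _ ⟨s, hs, rfl⟩; exact hbound s hs⟩
    obtain ⟨s, hs, hk⟩ := Nat.sSup_mem hne hbdd
    exact ⟨s, hs, fun t ht => hk ▸ le_csSup hbdd ⟨t, ht, rfl⟩⟩
  obtain ⟨s, hs, hsmax⟩ := hmax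
  refine ⟨s.image fun c => (1 / 2 : ℝ) • c, Finset.card_image_le.trans (hbound s hs), ?_, ?_⟩
  · intro y hy
    obtain ⟨c, hc, rfl⟩ := Finset.mem_image.mp hy
    rw [norm_smul, hs.1 c hc]
    norm_num
  · intro u hu
    by_contra! hcon
    have hfar : ∀ c ∈ s, 1 ≤ ‖(2 : ℝ) • u - c‖ := by
      intro c hc
      have h1 := hcon _ (Finset.mem_image_of_mem _ hc)
      have h2 : (2 : ℝ) • u - c = (2 : ℝ) • (u - (1 / 2 : ℝ) • c) := by
        rw [smul_sub, smul_smul]; norm_num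
      rw [h2, norm_smul, Real.norm_ofNat]
      linarith
    have hnot : (2 : ℝ) • u ∉ s := by
      intro h
      have := hfar _ h
      rw [sub_self, norm_zero] at this
      linarith
    have hgood : good (insert ((2 : ℝ) • u) s) := by
      refine ⟨?_, ?_⟩
      · intro c hc
        rcases Finset.mem_insert.mp hc with rfl | hc
        · rw [norm_smul, hu]; norm_num
        · exact hs.1 c hc
      · intro c hc d hd hcd
        rcases Finset.mem_insert.mp hc with rfl | hc <;> rcases Finset.mem_insert.mp hd with rfl | hd
        · exact absurd rfl hcd
        · exact hfar d hd
        · rw [norm_sub_rev]; exact hfar c hc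
        · exact hs.2 c hc d hd hcd
    have := hsmax _ hgood
    rw [Finset.card_insert_of_notMem hnot] at this
    omega

/-- The distortion of the squared norm under a linear map is controlled by its values on a net. -/
theorem abs_norm_sq_map_sub_le_of_net (L : V →ₗ[ℝ] F) {N : Finset V} (hN : ∀ y ∈ N, ‖y‖ = 1)
    (hnet : ∀ u : V, ‖u‖ = 1 → ∃ y ∈ N, ‖u - y‖ ≤ 1 / 2) {t : ℝ}
    (ht : ∀ y ∈ N, |‖L y‖ ^ 2 - ‖y‖ ^ 2| ≤ t) (u : V) :
    |‖L u‖ ^ 2 - ‖u‖ ^ 2| ≤ 32 * t * ‖u‖ ^ 2 := by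
  let Q : V → ℝ := fun v => ‖L v‖ ^ 2 - ‖v‖ ^ 2
  have hsmul : ∀ (a : ℝ) v, Q (a • v) = a ^ 2 * Q v := by
    intro a v
    simp only [Q, map_smul, norm_smul, mul_pow, Real.norm_eq_abs, sq_abs]
    ring
  rcases eq_or_ne u 0 with rfl | hu
  · simp
  have hL : Continuous L := L.continuous_of_finiteDimensional
  have hQ : Continuous fun v => |Q v| := by fun_prop
  have hunit : ∀ v : V, v ≠ 0 → ‖(‖v‖⁻¹ : ℝ) • v‖ = 1 := fun v hv => norm_smul_inv_norm (𝕜 := ℝ) hv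
  obtain ⟨v₀, hv₀, hmax⟩ := (isCompact_sphere (0 : V) 1).exists_isMaxOn
    ⟨(‖u‖⁻¹ : ℝ) • u, by simpa using hunit u hu⟩ hQ.continuousOn
  rw [mem_sphere_zero_iff_norm] at hv₀
  set M := |Q v₀| with hM
  have hle : ∀ v, |Q v| ≤ M * ‖v‖ ^ 2 := by
    intro v
    rcases eq_or_ne v 0 with rfl | hv
    · simp [Q]
    · have h1 : |Q ((‖v‖⁻¹ : ℝ) • v)| ≤ M :=
        hmax (by rw [mem_sphere_zero_iff_norm]; exact hunit v hv)
      have hpos : 0 < ‖v‖ ^ 2 := by positivity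
      rw [hsmul, inv_pow, abs_mul, abs_of_nonneg (by positivity), inv_mul_le_iff₀ hpos] at h1
      linarith
  obtain ⟨y, hy, hdist⟩ := hnet v₀ hv₀
  have hy1 := hN y hy
  have hM32 : M ≤ 32 * t := by
    have hpar : Q v₀ - Q y = (Q ((5 / 2 : ℝ) • v₀ - (3 / 2 : ℝ) • y)
        - Q ((3 / 2 : ℝ) • v₀ - (5 / 2 : ℝ) • y)) / 4 := by
      simp only [Q, map_sub, map_smul, norm_sub_sq_real, norm_smul, real_inner_smul_left,
        real_inner_smul_right, mul_pow, Real.norm_eq_abs, sq_abs]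
      ring
    have hin : 7 / 8 ≤ inner ℝ v₀ y := by
      have h1 := norm_sub_sq_real v₀ y
      have h2 : ‖v₀ - y‖ ^ 2 ≤ (1 / 2) ^ 2 := by gcongr
      rw [hv₀, hy1] at h1
      linarith
    have ha := hle ((5 / 2 : ℝ) • v₀ - (3 / 2 : ℝ) • y)
    have hb := hle ((3 / 2 : ℝ) • v₀ - (5 / 2 : ℝ) • y)
    simp only [norm_sub_sq_real, norm_smul, real_inner_smul_left, real_inner_smul_right, mul_pow,
      Real.norm_eq_abs, sq_abs, hv₀, hy1] at ha hb
    have hM0 : 0 ≤ M := abs_nonneg _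
    have hty := ht y hy
    have htri : M ≤ |Q y| + |Q v₀ - Q y| := by
      have := abs_add_le (Q y) (Q v₀ - Q y)
      rwa [add_sub_cancel] at this
    have hdiff : |Q v₀ - Q y| ≤ 31 / 32 * M := by
      rw [hpar, abs_div, abs_of_pos (by norm_num : (0 : ℝ) < 4)]
      have h3 := abs_sub (Q ((5 / 2 : ℝ) • v₀ - (3 / 2 : ℝ) • y))
        (Q ((3 / 2 : ℝ) • v₀ - (5 / 2 : ℝ) • y))
      have h4 : M * (7 / 8) ≤ M * inner ℝ v₀ y := by gcongr
      nlinarith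
    change |Q y| ≤ t at hty
    linarith
  exact (hle u).trans (by gcongr)

end Net

section Signs

/-- The sign `±1` encoded by a Boolean. -/
def boolSign (b : Bool) : ℝ := if b then 1 else -1

theorem exp_mul_sq_sum_signs_le {s u : ℝ} (a : ℝ) :
    Real.exp (s * (u + a) ^ 2) + Real.exp (s * (-u + a) ^ 2)
      ≤ 2 * (Real.exp (s * u ^ 2) * Real.exp ((s + 2 * s ^ 2 * u ^ 2) * a ^ 2)) := by
  have h1 : Real.exp (s * (u + a) ^ 2) + Real.exp (s * (-u + a) ^ 2)
      = 2 * (Real.exp (s * u ^ 2 + s * a ^ 2) * Real.cosh (2 * s * a * u)) := by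
    rw [Real.cosh_eq]
    have e1 : Real.exp (s * (u + a) ^ 2)
        = Real.exp (s * u ^ 2 + s * a ^ 2) * Real.exp (2 * s * a * u) := by
      rw [← Real.exp_add]; ring_nf
    have e2 : Real.exp (s * (-u + a) ^ 2)
        = Real.exp (s * u ^ 2 + s * a ^ 2) * Real.exp (-(2 * s * a * u)) := by
      rw [← Real.exp_add]; ring_nf
    rw [e1, e2]; ring
  rw [h1]
  refine mul_le_mul_of_nonneg_left ?_ (by norm_num)
  calc Real.exp (s * u ^ 2 + s * a ^ 2) * Real.cosh (2 * s * a * u)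
      ≤ Real.exp (s * u ^ 2 + s * a ^ 2) * Real.exp ((2 * s * a * u) ^ 2 / 2) := by
        gcongr; exact Real.cosh_le_exp_half_sq _
    _ = _ := by rw [← Real.exp_add, ← Real.exp_add]; ring_nf

theorem rademacher_exponent_step {s V w : ℝ} (hV : 0 ≤ V) (hw : 0 ≤ w)
    (hs : |s| * (w + V) ≤ 1 / 8) :
    |s + 2 * s ^ 2 * w| * V ≤ 1 / 8 ∧
      s * w + ((s + 2 * s ^ 2 * w) * V + 4 * (s + 2 * s ^ 2 * w) ^ 2 * V ^ 2)
        ≤ s * (w + V) + 4 * s ^ 2 * (w + V) ^ 2 := by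
  have hr := abs_nonneg s
  have hrw : 0 ≤ |s| * w := by positivity
  have hrV : 0 ≤ |s| * V := by positivity
  constructor
  · have h1 : |s + 2 * s ^ 2 * w| ≤ |s| + 2 * |s| ^ 2 * w := by
      refine (abs_add_le _ _).trans ?_
      rw [abs_mul, abs_of_nonneg hw, abs_mul, abs_pow, abs_of_pos (by norm_num : (0 : ℝ) < 2)]
    calc |s + 2 * s ^ 2 * w| * V ≤ (|s| + 2 * |s| ^ 2 * w) * V := by gcongr
      _ = |s| * V + 2 * (|s| * w) * (|s| * V) := by ring
      _ ≤ 1 / 8 := by nlinarith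
  · have hsV : s * V ≤ 1 / 8 := by
      have := mul_le_mul_of_nonneg_right (le_abs_self s) hV
      linarith
    have h1 : 0 ≤ s ^ 2 * w * V * (1 / 8 - s * V) := by
      have : 0 ≤ 1 / 8 - s * V := by linarith
      positivity
    have h3 : 0 ≤ s ^ 2 * w * V := by positivity
    have h4 : (s * V) ^ 2 ≤ 1 / 64 := by
      rw [← sq_abs, abs_mul, abs_of_nonneg hV]
      nlinarith
    have h5 : 0 ≤ s ^ 2 * w ^ 2 * (1 / 64 - (s * V) ^ 2) := by
      have : 0 ≤ 1 / 64 - (s * V) ^ 2 := by linarith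
      positivity
    have h6 : 0 ≤ s ^ 2 * w ^ 2 := by positivity
    nlinarith

/-- Two-sided bound for the moment generating function of the square of a Rademacher sum. -/
theorem sum_exp_mul_sq_rademacher_le (p : ℕ) : ∀ (u : Fin p → ℝ) (s : ℝ),
    |s| * ∑ j, u j ^ 2 ≤ 1 / 8 →
    ∑ σ : Fin p → Bool, Real.exp (s * (∑ j, boolSign (σ j) * u j) ^ 2)
      ≤ 2 ^ p * Real.exp (s * ∑ j, u j ^ 2 + 4 * s ^ 2 * (∑ j, u j ^ 2) ^ 2) := by
  induction p with
  | zero => intro u s _; simp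
  | succ p ih =>
    intro u s hs
    set V := ∑ j : Fin p, u j.succ ^ 2 with hV
    have hV0 : 0 ≤ V := by positivity
    have hU : ∑ j, u j ^ 2 = u 0 ^ 2 + V := Fin.sum_univ_succ _
    rw [hU] at hs ⊢
    obtain ⟨hs', hexp⟩ := rademacher_exponent_step hV0 (sq_nonneg (u 0)) hs
    rw [← (Fin.consEquiv fun _ => Bool).sum_comp, Fintype.sum_prod_type, Fintype.sum_bool,
      ← Finset.sum_add_distrib]
    calc _ ≤ ∑ σ : Fin p → Bool, 2 * (Real.exp (s * u 0 ^ 2) *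
          Real.exp ((s + 2 * s ^ 2 * u 0 ^ 2) * (∑ j, boolSign (σ j) * u j.succ) ^ 2)) := by
          refine Finset.sum_le_sum fun σ _ => ?_
          have := exp_mul_sq_sum_signs_le (s := s) (u := u 0) (∑ j, boolSign (σ j) * u j.succ)
          simpa [Fin.sum_univ_succ, Fin.consEquiv, boolSign] using this
      _ = 2 * Real.exp (s * u 0 ^ 2) * ∑ σ : Fin p → Bool,
          Real.exp ((s + 2 * s ^ 2 * u 0 ^ 2) * (∑ j, boolSign (σ j) * u j.succ) ^ 2) := by
          rw [Finset.mul_sum]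
          refine Finset.sum_congr rfl fun σ _ => by ring
      _ ≤ 2 * Real.exp (s * u 0 ^ 2) * (2 ^ p * Real.exp ((s + 2 * s ^ 2 * u 0 ^ 2) * V
          + 4 * (s + 2 * s ^ 2 * u 0 ^ 2) ^ 2 * V ^ 2)) := by
          gcongr
          exact ih _ _ hs'
      _ = 2 ^ (p + 1) * Real.exp (s * u 0 ^ 2 + ((s + 2 * s ^ 2 * u 0 ^ 2) * V
          + 4 * (s + 2 * s ^ 2 * u 0 ^ 2) ^ 2 * V ^ 2)) := by
          rw [Real.exp_add (s * u 0 ^ 2)]; ring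
      _ ≤ _ := by gcongr

variable {p q : ℕ}

/-- The `q × p` matrix with entries `±1/√q` whose signs are given by `σ`. -/
noncomputable def signMatrix (σ : Fin q → Fin p → Bool) : Matrix (Fin q) (Fin p) ℝ :=
  Matrix.of fun i j => boolSign (σ i j) * (1 / √(q : ℝ))

/-- The linear map of Euclidean spaces given by `signMatrix σ`. -/
noncomputable def signMap (σ : Fin q → Fin p → Bool) :
    EuclideanSpace ℝ (Fin p) →ₗ[ℝ] EuclideanSpace ℝ (Fin q) :=
  Matrix.toLpLin 2 2 (signMatrix σ)

theorem norm_sq_signMap (σ : Fin q → Fin p → Bool) (u : EuclideanSpace ℝ (Fin p)) :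
    ‖signMap σ u‖ ^ 2 = (q : ℝ)⁻¹ * ∑ i, (∑ j, boolSign (σ i j) * u j) ^ 2 := by
  rw [EuclideanSpace.norm_sq_eq, Finset.mul_sum]
  refine Finset.sum_congr rfl fun i _ => ?_
  have h : (signMap σ u) i = (1 / √(q : ℝ)) * ∑ j, boolSign (σ i j) * u j := by
    simp only [signMap, Matrix.toLpLin_apply, Matrix.mulVec, dotProduct, signMatrix,
      Matrix.of_apply, Finset.mul_sum]
    exact Finset.sum_congr rfl fun j _ => by ring
  rw [h, Real.norm_eq_abs, sq_abs, mul_pow, div_pow, Real.sq_sqrt (Nat.cast_nonneg q), one_pow,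
    one_div]

/-- The distortion of the squared norm of `u` under the sign matrix `σ`. -/
noncomputable def distortion (σ : Fin q → Fin p → Bool) (u : EuclideanSpace ℝ (Fin p)) : ℝ :=
  ‖signMap σ u‖ ^ 2 - ‖u‖ ^ 2

theorem distortion_smul (σ : Fin q → Fin p → Bool) (a : ℝ) (u : EuclideanSpace ℝ (Fin p)) :
    distortion σ (a • u) = a ^ 2 * distortion σ u := by
  simp only [distortion, map_smul, norm_smul, mul_pow, Real.norm_eq_abs, sq_abs]
  ring

variable (p q) in
/-- The number of sign patterns of a `q × p` matrix. -/
noncomputable def numSigns : ℝ := (2 ^ p) ^ q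

theorem numSigns_pos : 0 < numSigns p q := by unfold numSigns; positivity

theorem card_signs : (Fintype.card (Fin q → Fin p → Bool) : ℝ) = numSigns p q := by
  simp [numSigns]

theorem sum_exp_distortion_le (hq : 0 < q) {u : EuclideanSpace ℝ (Fin p)} (hu : ‖u‖ = 1) {s : ℝ}
    (hs : |s| ≤ q / 8) :
    ∑ σ : Fin q → Fin p → Bool, Real.exp (s * distortion σ u)
      ≤ numSigns p q * Real.exp (4 * s ^ 2 / q) := by
  have hq' : (0 : ℝ) < q := by exact_mod_cast hq
  have hu2 : ∑ j, u j ^ 2 = 1 := by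
    have h := EuclideanSpace.norm_sq_eq u
    rw [hu] at h
    simpa using h.symm
  have hrow := sum_exp_mul_sq_rademacher_le p u (s / q) (by
    rw [hu2, mul_one, abs_div, abs_of_pos hq', div_le_iff₀ hq']; linarith)
  rw [hu2] at hrow
  calc ∑ σ : Fin q → Fin p → Bool, Real.exp (s * distortion σ u)
      = Real.exp (-s) * ∑ σ : Fin q → Fin p → Bool,
          ∏ i, Real.exp (s / q * (∑ j, boolSign (σ i j) * u j) ^ 2) := by
        rw [Finset.mul_sum]
        refine Finset.sum_congr rfl fun σ _ => ?_
        rw [← Real.exp_sum, ← Finset.mul_sum, ← Real.exp_add, distortion, norm_sq_signMap, hu]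
        congr 1
        field_simp
        ring
    _ = Real.exp (-s) * (∑ τ : Fin p → Bool,
          Real.exp (s / q * (∑ j, boolSign (τ j) * u j) ^ 2)) ^ q := by
        have h := Fintype.prod_sum (fun (_ : Fin q) (τ : Fin p → Bool) =>
          Real.exp (s / q * (∑ j, boolSign (τ j) * u j) ^ 2))
        rw [← h, Finset.prod_const, Finset.card_univ, Fintype.card_fin]
    _ ≤ Real.exp (-s) * (2 ^ p * Real.exp (s / q * 1 + 4 * (s / q) ^ 2 * 1 ^ 2)) ^ q := by
        gcongr
    _ = _ := by
        rw [mul_pow, ← Real.exp_nat_mul, numSigns, mul_left_comm, ← Real.exp_add]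
        congr 2
        field_simp
        ring

/-- Second moment bound for the distortion. -/
theorem sum_distortion_sq_le (hq : 0 < q) (u : EuclideanSpace ℝ (Fin p)) :
    ∑ σ : Fin q → Fin p → Bool, distortion σ u ^ 2 ≤ numSigns p q * (16 / q) * ‖u‖ ^ 4 := by
  have hq' : (1 : ℝ) ≤ q := by exact_mod_cast hq
  have hq0 : (0 : ℝ) < q := by linarith
  wlog hu : ‖u‖ = 1 generalizing u
  · rcases eq_or_ne u 0 with rfl | h0
    · simp [distortion]
    · have hunit : ‖(‖u‖⁻¹ : ℝ) • u‖ = 1 := norm_smul_inv_norm (𝕜 := ℝ) h0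
      have h1 := this ((‖u‖⁻¹ : ℝ) • u) hunit
      have hn : 0 < ‖u‖ := norm_pos_iff.mpr h0
      simp only [distortion_smul, mul_pow, ← Finset.mul_sum] at h1
      rw [hunit] at h1
      have h2 : ∑ σ : Fin q → Fin p → Bool, distortion σ u ^ 2
          = ‖u‖ ^ 4 * (((‖u‖⁻¹) ^ 2) ^ 2 * ∑ σ : Fin q → Fin p → Bool, distortion σ u ^ 2) := by
        field_simp
      rw [h2]
      calc _ ≤ ‖u‖ ^ 4 * (numSigns p q * (16 / q) * 1 ^ 4) := by gcongr
        _ = _ := by ring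
  have hsq : √(q : ℝ) ^ 2 = q := Real.sq_sqrt hq0.le
  have hs1 : √(q : ℝ) ≤ q := by
    rw [Real.sqrt_le_left hq0.le]; nlinarith
  set s := √(q : ℝ) / 8 with hs
  have hs0 : 0 ≤ s := by positivity
  have hs2 : s ^ 2 = q / 64 := by rw [hs, div_pow, hsq]; norm_num
  have hA := sum_exp_distortion_le (p := p) hq hu (s := s) (by rw [abs_of_nonneg hs0]; linarith)
  have hB := sum_exp_distortion_le (p := p) hq hu (s := -s)
    (by rw [abs_neg, abs_of_nonneg hs0]; linarith)
  have he : 4 * s ^ 2 / q = 1 / 16 := by rw [hs2]; field_simp; norm_num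
  rw [neg_sq] at hB
  rw [he] at hA hB
  have hexp : Real.exp (1 / 16) ≤ 1 + 1 / 8 := by
    have := Real.exp_bound_div_one_sub_of_interval (x := 1 / 16) (by norm_num) (by norm_num)
    refine this.trans (by norm_num)
  have hpt : ∀ x : ℝ, x ^ 2 ≤ Real.exp x + Real.exp (-x) - 2 := by
    intro x
    have h1 : (x / 2) ^ 2 ≤ Real.sinh (x / 2) ^ 2 := by
      rcases le_total 0 (x / 2) with h | h
      · exact pow_le_pow_left₀ h (Real.self_le_sinh_iff.mpr h) 2
      · have := Real.sinh_le_self_iff.mpr h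
        nlinarith
    have h2 : Real.exp x + Real.exp (-x) - 2 = 4 * Real.sinh (x / 2) ^ 2 := by
      have e1 := Real.cosh_two_mul (x / 2)
      have e2 := Real.cosh_sq (x / 2)
      rw [mul_div_cancel₀ x two_ne_zero, Real.cosh_eq] at e1
      linarith
    linarith
  have hsum : ∑ σ : Fin q → Fin p → Bool, (s * distortion σ u) ^ 2
      ≤ numSigns p q * (1 / 4) := by
    calc ∑ σ : Fin q → Fin p → Bool, (s * distortion σ u) ^ 2
        ≤ ∑ σ : Fin q → Fin p → Bool,
          (Real.exp (s * distortion σ u) + Real.exp (-s * distortion σ u) - 2) := by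
          refine Finset.sum_le_sum fun σ _ => ?_
          rw [neg_mul]
          exact hpt _
      _ = ∑ σ : Fin q → Fin p → Bool, Real.exp (s * distortion σ u)
          + ∑ σ : Fin q → Fin p → Bool, Real.exp (-s * distortion σ u) - numSigns p q * 2 := by
          rw [Finset.sum_sub_distrib, Finset.sum_add_distrib, Finset.sum_const, nsmul_eq_mul,
            Finset.card_univ, card_signs]
      _ ≤ _ := by
          have := numSigns_pos (p := p) (q := q)
          nlinarith
  simp only [mul_pow, ← Finset.mul_sum, hs2] at hsum
  rw [hu]
  have : ∑ σ : Fin q → Fin p → Bool, distortion σ u ^ 2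
      = (64 / q) * (q / 64 * ∑ σ : Fin q → Fin p → Bool, distortion σ u ^ 2) := by
    field_simp
  rw [this]
  calc _ ≤ (64 / q) * (numSigns p q * (1 / 4)) := by gcongr
    _ = _ := by ring

/-- Markov's inequality for the uniform distribution on a finite type. -/
theorem card_filter_mul_le_sum {β : Type*} [Fintype β] (f : β → ℝ) (hf : ∀ b, 0 ≤ f b) (a : ℝ)
    (P : β → Prop) [DecidablePred P] (hP : ∀ b, P b → a ≤ f b) :
    ((Finset.univ.filter P).card : ℝ) * a ≤ ∑ b, f b := by
  calc ((Finset.univ.filter P).card : ℝ) * a = ∑ b with P b, a := by simp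
    _ ≤ ∑ b with P b, f b := Finset.sum_le_sum fun b hb => hP b (Finset.mem_filter.mp hb).2
    _ ≤ ∑ b, f b := Finset.sum_le_sum_of_subset_of_nonneg (Finset.filter_subset _ _)
        fun b _ _ => hf b

open Classical in
theorem card_abs_distortion_gt_le (hq : 0 < q) {u : EuclideanSpace ℝ (Fin p)} (hu : ‖u‖ = 1)
    {t : ℝ} (ht : 0 ≤ t) (ht1 : t ≤ 1) :
    ((Finset.univ.filter fun σ : Fin q → Fin p → Bool => t < |distortion σ u|).card : ℝ)
      ≤ numSigns p q * (2 * Real.exp (-(q * t ^ 2 / 16))) := by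
  have hq0 : (0 : ℝ) < q := by exact_mod_cast hq
  set s : ℝ := q * t / 8 with hs
  have hs0 : 0 ≤ s := by positivity
  have hsq : s ≤ q / 8 := by rw [hs]; gcongr; nlinarith
  have hA := sum_exp_distortion_le (p := p) hq hu (s := s) (by rwa [abs_of_nonneg hs0])
  have hB := sum_exp_distortion_le (p := p) hq hu (s := -s) (by rwa [abs_neg, abs_of_nonneg hs0])
  rw [neg_sq] at hB
  have hmarkov := card_filter_mul_le_sum
    (fun σ : Fin q → Fin p → Bool => Real.exp (s * distortion σ u) + Real.exp (-s * distortion σ u))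
    (fun σ => by positivity) (Real.exp (s * t)) (fun σ => t < |distortion σ u|) (by
      intro σ hσ
      rcases lt_abs.mp hσ with h | h
      · have : Real.exp (s * t) ≤ Real.exp (s * distortion σ u) := by gcongr
        have := Real.exp_pos (-s * distortion σ u)
        linarith
      · have : Real.exp (s * t) ≤ Real.exp (-s * distortion σ u) := by
          rw [neg_mul, ← mul_neg]; gcongr
        have := Real.exp_pos (s * distortion σ u)
        linarith)
  rw [Finset.sum_add_distrib] at hmarkov
  have he : Real.exp (4 * s ^ 2 / q) = Real.exp (-(q * t ^ 2 / 16)) * Real.exp (s * t) := by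
    rw [← Real.exp_add]
    congr 1
    rw [hs]
    field_simp
    ring
  rw [he] at hA hB
  refine le_of_mul_le_mul_right ?_ (Real.exp_pos (s * t))
  linarith

end Signs

section Sketch

open Classical
open scoped InnerProductSpace

variable {p q n : ℕ}

theorem card_sum_distortion_gt_le (hq : 0 < q) (y : Fin n → EuclideanSpace ℝ (Fin p)) {δ : ℝ}
    (hδ : 0 < δ) :
    ((Finset.univ.filter fun σ : Fin q → Fin p → Bool =>
      δ * ∑ i, ‖y i‖ ^ 2 < ∑ i, distortion σ (y i)).card : ℝ)
      ≤ numSigns p q * (16 / (q * δ ^ 2)) := by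
  have hq0 : (0 : ℝ) < q := by exact_mod_cast hq
  have hN := numSigns_pos (p := p) (q := q)
  set A := ∑ i, ‖y i‖ ^ 2 with hA
  have hA0 : 0 ≤ A := by positivity
  have hzero : ∀ i, ‖y i‖ = 0 → ∀ σ : Fin q → Fin p → Bool, distortion σ (y i) = 0 := by
    intro i hi σ
    rw [norm_eq_zero.mp hi]
    simp [distortion]
  rcases hA0.eq_or_lt with h0 | hApos
  · have hy : ∀ i, ‖y i‖ = 0 := by
      intro i
      have := (Finset.sum_eq_zero_iff_of_nonneg (fun i _ => by positivity)).mp (hA ▸ h0.symm) i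
        (Finset.mem_univ i)
      exact pow_eq_zero_iff two_ne_zero |>.mp this
    have : (Finset.univ.filter fun σ : Fin q → Fin p → Bool =>
        δ * A < ∑ i, distortion σ (y i)) = ∅ := by
      refine Finset.filter_eq_empty_iff.mpr fun σ _ => ?_
      rw [← h0, Finset.sum_eq_zero fun i _ => hzero i (hy i) σ]
      simp
    rw [this, Finset.card_empty, Nat.cast_zero]
    positivity
  have hcs : ∀ σ : Fin q → Fin p → Bool,
      (∑ i, distortion σ (y i)) ^ 2 ≤ A * ∑ i, distortion σ (y i) ^ 2 / ‖y i‖ ^ 2 := by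
    intro σ
    refine Finset.sum_sq_le_sum_mul_sum_of_sq_le_mul _ (fun i _ => by positivity)
      (fun i _ => by positivity) fun i _ => ?_
    rcases eq_or_ne ‖y i‖ 0 with h | h
    · rw [hzero i h]; simp
    · field_simp; exact le_refl _
  have hmom : ∑ σ : Fin q → Fin p → Bool, (∑ i, distortion σ (y i)) ^ 2
      ≤ numSigns p q * (16 / q) * A ^ 2 := by
    calc ∑ σ : Fin q → Fin p → Bool, (∑ i, distortion σ (y i)) ^ 2
        ≤ ∑ σ : Fin q → Fin p → Bool, A * ∑ i, distortion σ (y i) ^ 2 / ‖y i‖ ^ 2 :=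
          Finset.sum_le_sum fun σ _ => hcs σ
      _ = A * ∑ i, (∑ σ : Fin q → Fin p → Bool, distortion σ (y i) ^ 2) / ‖y i‖ ^ 2 := by
          rw [← Finset.mul_sum, Finset.sum_comm]
          simp only [Finset.sum_div]
      _ ≤ A * ∑ i, numSigns p q * (16 / q) * ‖y i‖ ^ 2 := by
          gcongr with i
          rcases eq_or_ne ‖y i‖ 0 with h | h
          · rw [h]; simp
          · have hpos : 0 < ‖y i‖ ^ 2 := by positivity
            rw [div_le_iff₀ hpos]
            refine (sum_distortion_sq_le hq (y i)).trans (le_of_eq (by ring))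
      _ = _ := by rw [← Finset.mul_sum]; ring
  have hmarkov := card_filter_mul_le_sum
    (fun σ : Fin q → Fin p → Bool => (∑ i, distortion σ (y i)) ^ 2) (fun σ => by positivity)
    ((δ * A) ^ 2) (fun σ => δ * A < ∑ i, distortion σ (y i)) (by
      intro σ hσ
      have : 0 ≤ δ * A := by positivity
      gcongr)
  have hpos : 0 < (δ * A) ^ 2 := by positivity
  refine le_of_mul_le_mul_right ((hmarkov.trans hmom).trans (le_of_eq ?_)) hpos
  field_simp

theorem sum_inner_signMap_sq_le (hq : 0 < q) {e w : EuclideanSpace ℝ (Fin p)} (he : ‖e‖ = 1)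
    (hew : ⟪e, w⟫_ℝ = 0) :
    ∑ σ : Fin q → Fin p → Bool, ⟪signMap σ e, signMap σ w⟫_ℝ ^ 2
      ≤ numSigns p q * (16 / q) * ‖w‖ ^ 2 := by
  have hq0 : (0 : ℝ) < q := by exact_mod_cast hq
  wlog hw : ‖w‖ = 1 generalizing w
  · rcases eq_or_ne w 0 with rfl | h0
    · simp
    · have hunit : ‖(‖w‖⁻¹ : ℝ) • w‖ = 1 := norm_smul_inv_norm (𝕜 := ℝ) h0
      have h1 := this (w := (‖w‖⁻¹ : ℝ) • w) (by rw [real_inner_smul_right, hew, mul_zero]) hunit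
      have hn : 0 < ‖w‖ := norm_pos_iff.mpr h0
      simp only [map_smul, real_inner_smul_right, mul_pow, ← Finset.mul_sum] at h1
      rw [hunit, inv_pow, inv_mul_le_iff₀ (by positivity)] at h1
      linarith
  have hplus : ‖e + w‖ ^ 2 = 2 := by rw [norm_add_sq_real, he, hw, hew]; norm_num
  have hminus : ‖e - w‖ ^ 2 = 2 := by rw [norm_sub_sq_real, he, hw, hew]; norm_num
  have hpol : ∀ σ : Fin q → Fin p → Bool, ⟪signMap σ e, signMap σ w⟫_ℝ
      = (distortion σ (e + w) - distortion σ (e - w)) / 4 := by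
    intro σ
    simp only [distortion, hplus, hminus, map_add, map_sub, norm_add_sq_real, norm_sub_sq_real]
    ring
  have h1 := sum_distortion_sq_le (q := q) hq (e + w)
  have h2 := sum_distortion_sq_le (q := q) hq (e - w)
  have e1 : ‖e + w‖ ^ 4 = 4 := by
    rw [show ‖e + w‖ ^ 4 = (‖e + w‖ ^ 2) ^ 2 by ring, hplus]; norm_num
  have e2 : ‖e - w‖ ^ 4 = 4 := by
    rw [show ‖e - w‖ ^ 4 = (‖e - w‖ ^ 2) ^ 2 by ring, hminus]; norm_num
  rw [e1] at h1
  rw [e2] at h2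
  calc ∑ σ : Fin q → Fin p → Bool, ⟪signMap σ e, signMap σ w⟫_ℝ ^ 2
      ≤ ∑ σ : Fin q → Fin p → Bool,
          (1 / 8 * distortion σ (e + w) ^ 2 + 1 / 8 * distortion σ (e - w) ^ 2) := by
        refine Finset.sum_le_sum fun σ _ => ?_
        rw [hpol σ]
        nlinarith [sq_nonneg (distortion σ (e + w) + distortion σ (e - w))]
    _ ≤ _ := by
        rw [Finset.sum_add_distrib, ← Finset.mul_sum, ← Finset.mul_sum, hw]
        linarith

theorem card_sum_inner_gt_le (hq : 0 < q) {d : ℕ} (e : Fin d → EuclideanSpace ℝ (Fin p))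
    (w : Fin n → EuclideanSpace ℝ (Fin p)) (he : ∀ l, ‖e l‖ = 1) (hew : ∀ l i, ⟪e l, w i⟫_ℝ = 0)
    {δ : ℝ} (hδ : 0 < δ) :
    ((Finset.univ.filter fun σ : Fin q → Fin p → Bool =>
      δ ^ 2 * ∑ i, ‖w i‖ ^ 2 < ∑ i, ∑ l, ⟪signMap σ (e l), signMap σ (w i)⟫_ℝ ^ 2).card : ℝ)
      ≤ numSigns p q * (16 * d / (q * δ ^ 2)) := by
  have hq0 : (0 : ℝ) < q := by exact_mod_cast hq
  have hN := numSigns_pos (p := p) (q := q)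
  set A := ∑ i, ‖w i‖ ^ 2 with hA
  have hA0 : 0 ≤ A := by positivity
  rcases hA0.eq_or_lt with h0 | hApos
  · have hw : ∀ i, w i = 0 := by
      intro i
      have := (Finset.sum_eq_zero_iff_of_nonneg (fun i _ => by positivity)).mp (hA ▸ h0.symm) i
        (Finset.mem_univ i)
      exact norm_eq_zero.mp (pow_eq_zero_iff two_ne_zero |>.mp this)
    have : (Finset.univ.filter fun σ : Fin q → Fin p → Bool =>
        δ ^ 2 * A < ∑ i, ∑ l, ⟪signMap σ (e l), signMap σ (w i)⟫_ℝ ^ 2) = ∅ := by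
      refine Finset.filter_eq_empty_iff.mpr fun σ _ => ?_
      simp [hw, ← h0]
    rw [this, Finset.card_empty, Nat.cast_zero]
    positivity
  have hmom : ∑ σ : Fin q → Fin p → Bool, ∑ i, ∑ l, ⟪signMap σ (e l), signMap σ (w i)⟫_ℝ ^ 2
      ≤ numSigns p q * (16 * d / q) * A := by
    rw [Finset.sum_comm, hA, Finset.mul_sum]
    refine Finset.sum_le_sum fun i _ => ?_
    rw [Finset.sum_comm]
    calc _ ≤ ∑ _l : Fin d, numSigns p q * (16 / q) * ‖w i‖ ^ 2 :=
          Finset.sum_le_sum fun l _ => sum_inner_signMap_sq_le hq (he l) (hew l i)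
      _ = _ := by
          rw [Finset.sum_const, Finset.card_univ, Fintype.card_fin, nsmul_eq_mul]; ring
  have hmarkov := card_filter_mul_le_sum
    (fun σ : Fin q → Fin p → Bool => ∑ i, ∑ l, ⟪signMap σ (e l), signMap σ (w i)⟫_ℝ ^ 2)
    (fun σ => by positivity) (δ ^ 2 * A)
    (fun σ => δ ^ 2 * A < ∑ i, ∑ l, ⟪signMap σ (e l), signMap σ (w i)⟫_ℝ ^ 2)
    (fun σ hσ => hσ.le)
  have hpos : 0 < δ ^ 2 * A := by positivity
  refine le_of_mul_le_mul_right ((hmarkov.trans hmom).trans (le_of_eq ?_)) hpos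
  field_simp

/-- With few exceptions, sign matrices nearly preserve the norms of all vectors of a subspace. -/
theorem card_not_subspace_embedding_le (hq : 0 < q)
    (U : Submodule ℝ (EuclideanSpace ℝ (Fin p))) {t : ℝ} (ht : 0 ≤ t) (ht1 : t ≤ 1) :
    ((Finset.univ.filter fun σ : Fin q → Fin p → Bool =>
      ¬ ∀ u ∈ U, (1 - 32 * t) * ‖u‖ ^ 2 ≤ ‖signMap σ u‖ ^ 2).card : ℝ)
      ≤ numSigns p q * (5 ^ Module.finrank ℝ U * (2 * Real.exp (-(q * t ^ 2 / 16)))) := by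
  have hN := numSigns_pos (p := p) (q := q)
  obtain ⟨N, hcard, hunit, hnet⟩ := exists_net_unit_sphere U
  have hsub : (Finset.univ.filter fun σ : Fin q → Fin p → Bool =>
      ¬ ∀ u ∈ U, (1 - 32 * t) * ‖u‖ ^ 2 ≤ ‖signMap σ u‖ ^ 2)
      ⊆ N.biUnion fun y => Finset.univ.filter fun σ : Fin q → Fin p → Bool =>
        t < |distortion σ (y : EuclideanSpace ℝ (Fin p))| := by
    intro σ hσ
    by_contra hcon
    refine (Finset.mem_filter.mp hσ).2 fun u hu => ?_
    have hy : ∀ y ∈ N, |‖(signMap σ ∘ₗ U.subtype) y‖ ^ 2 - ‖y‖ ^ 2| ≤ t := by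
      intro y hy
      by_contra! h
      exact hcon (Finset.mem_biUnion.mpr ⟨y, hy, Finset.mem_filter.mpr ⟨Finset.mem_univ _, h⟩⟩)
    have h1 := abs_norm_sq_map_sub_le_of_net (signMap σ ∘ₗ U.subtype) hunit hnet hy ⟨u, hu⟩
    have h2 := (abs_le.mp h1).1
    simp only [LinearMap.comp_apply, Submodule.subtype_apply, Submodule.coe_norm] at h2
    linarith
  calc _ ≤ ((N.biUnion fun y => Finset.univ.filter fun σ : Fin q → Fin p → Bool =>
        t < |distortion σ (y : EuclideanSpace ℝ (Fin p))|).card : ℝ) := by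
        exact_mod_cast Finset.card_le_card hsub
    _ ≤ ∑ y ∈ N, ((Finset.univ.filter fun σ : Fin q → Fin p → Bool =>
        t < |distortion σ (y : EuclideanSpace ℝ (Fin p))|).card : ℝ) := by
        exact_mod_cast Finset.card_biUnion_le
    _ ≤ ∑ y ∈ N, numSigns p q * (2 * Real.exp (-(q * t ^ 2 / 16))) :=
        Finset.sum_le_sum fun y hy => card_abs_distortion_gt_le hq (hunit y hy) ht ht1
    _ = N.card * (numSigns p q * (2 * Real.exp (-(q * t ^ 2 / 16)))) := by
        rw [Finset.sum_const, nsmul_eq_mul]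
    _ ≤ 5 ^ Module.finrank ℝ U * (numSigns p q * (2 * Real.exp (-(q * t ^ 2 / 16)))) := by
        gcongr
        exact_mod_cast hcard
    _ = _ := by ring

theorem sketch_signMatrix (σ : Fin q → Fin p → Bool) (x : Fin n → EuclideanSpace ℝ (Fin p)) :
    sketch (signMatrix σ) x = fun i => signMap σ (x i) := by
  funext i
  simp [sketch, signMap, Matrix.toLpLin_apply]

theorem two_mul_five_pow_mul_exp_le {m d : ℕ} (hm : 0 < m) (hd : d ≤ m) {r : ℝ}
    (hr : 8 * (m : ℝ) ≤ r) : 5 ^ d * (2 * Real.exp (-r)) ≤ 1 / 100 := by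
  have h8 : 5 * Real.exp (-8) ≤ 1 / 200 := by
    have h1 : (1000 : ℝ) ≤ Real.exp 8 := by
      have := Real.exp_one_gt_d9
      have h2 : Real.exp 8 = Real.exp 1 ^ 8 := by rw [← Real.exp_nat_mul]; norm_num
      rw [h2]
      calc (1000 : ℝ) ≤ 2.7 ^ 8 := by norm_num
        _ ≤ _ := by gcongr; linarith
    rw [Real.exp_neg]
    have : (Real.exp 8)⁻¹ ≤ 1000⁻¹ := inv_anti₀ (by norm_num) h1
    linarith
  have h80 : 0 ≤ 5 * Real.exp (-8) := by positivity
  calc (5 : ℝ) ^ d * (2 * Real.exp (-r)) ≤ 5 ^ m * (2 * Real.exp (-(8 * (m : ℝ)))) := by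
        gcongr
        norm_num
    _ = 2 * (5 * Real.exp (-8)) ^ m := by
        rw [mul_pow, ← Real.exp_nat_mul]
        ring_nf
    _ ≤ 2 * (5 * Real.exp (-8)) := by
        gcongr
        exact pow_le_of_le_one h80 (by linarith) hm.ne'
    _ ≤ 1 / 100 := by linarith

/-- For all but a small fraction of the sign matrices `σ`, near-optimal partitions of the sketched
data are near-optimal for the data itself. -/
theorem card_good_signs_ge {m : ℕ} (hm : 0 < m) (x : Fin n → EuclideanSpace ℝ (Fin p))
    (Sopt : Fin n → Fin m) (hSopt : IsPartition Sopt) {ε : ℝ} (hε : 0 < ε) (hε' : ε < 1 / 3)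
    (hq : 2 * 10 ^ 7 * m / ε ^ 2 ≤ q) :
    numSigns p q * 0.96 ≤ ((Finset.univ.filter fun σ : Fin q → Fin p → Bool =>
      ∀ α : ℝ, 1 ≤ α → ∀ S : Fin n → Fin m, IsNearOptimal α (sketch (signMatrix σ) x) S →
        kmeansCost x S ≤ α * ((2 + ε) * kmeansCost x Sopt)).card : ℝ) := by
  have hN := numSigns_pos (p := p) (q := q)
  have hm1 : (1 : ℝ) ≤ m := by exact_mod_cast hm
  have hq1 : 2 * 10 ^ 7 * (m : ℝ) ≤ q * ε ^ 2 := by rwa [div_le_iff₀ (by positivity)] at hq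
  have hq0 : 0 < q := by
    rcases Nat.eq_zero_or_pos q with h | h
    · rw [h] at hq1; norm_num at hq1; linarith
    · exact h
  have hq0' : (0 : ℝ) < q := by exact_mod_cast hq0
  set U : Submodule ℝ (EuclideanSpace ℝ (Fin p)) :=
    Submodule.span ℝ (Set.range (clusterMean x Sopt)) with hU
  have hd : Module.finrank ℝ U ≤ m := by
    have h := finrank_range_le_card (R := ℝ) (clusterMean x Sopt)
    rwa [Fintype.card_fin] at h
  set e := stdOrthonormalBasis ℝ U with he
  set δ := ε / 12 with hδ
  have hδ0 : 0 < δ := by positivity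
  have hδq : q * ε ^ 2 = q * δ ^ 2 * 144 := by rw [hδ]; ring
  set bad₁ : (Fin q → Fin p → Bool) → Prop := fun σ =>
    ¬ ∀ u ∈ U, (1 - 32 * (ε / 384)) * ‖u‖ ^ 2 ≤ ‖signMap σ u‖ ^ 2 with hbad₁
  set bad₂ : (Fin q → Fin p → Bool) → Prop := fun σ =>
    δ ^ 2 * ∑ i, ‖x i - U.starProjection (x i)‖ ^ 2
      < ∑ i, ∑ l, ⟪signMap σ (e l : EuclideanSpace ℝ (Fin p)),
        signMap σ (x i - U.starProjection (x i))⟫_ℝ ^ 2 with hbad₂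
  set bad₃ : (Fin q → Fin p → Bool) → Prop := fun σ =>
    δ * ∑ i, ‖x i - clusterMean x Sopt (Sopt i)‖ ^ 2
      < ∑ i, distortion σ (x i - clusterMean x Sopt (Sopt i)) with hbad₃
  have h₁ : ((Finset.univ.filter bad₁).card : ℝ) ≤ numSigns p q * (1 / 100) := by
    refine (card_not_subspace_embedding_le hq0 U (t := ε / 384) (by positivity)
      (by linarith)).trans ?_
    gcongr
    refine two_mul_five_pow_mul_exp_le hm hd ?_
    have : q * (ε / 384) ^ 2 / 16 = q * ε ^ 2 / 2359296 := by ring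
    rw [this, le_div_iff₀ (by norm_num)]
    linarith
  have h₂ : ((Finset.univ.filter bad₂).card : ℝ) ≤ numSigns p q * (1 / 100) := by
    refine (card_sum_inner_gt_le hq0 (fun l => (e l : EuclideanSpace ℝ (Fin p)))
      (fun i => x i - U.starProjection (x i)) (fun l => e.norm_eq_one l)
      (fun l i => Submodule.sub_starProjection_mem_orthogonal (x i) _ (e l).2) hδ0).trans ?_
    refine mul_le_mul_of_nonneg_left ?_ hN.le
    rw [div_le_iff₀ (by positivity)]
    have : (Module.finrank ℝ U : ℝ) ≤ m := by exact_mod_cast hd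
    linarith
  have h₃ : ((Finset.univ.filter bad₃).card : ℝ) ≤ numSigns p q * (1 / 100) := by
    refine (card_sum_distortion_gt_le hq0 (fun i => x i - clusterMean x Sopt (Sopt i))
      hδ0).trans ?_
    refine mul_le_mul_of_nonneg_left ?_ hN.le
    rw [div_le_iff₀ (by positivity)]
    linarith
  have hgood : ∀ σ, ¬ (bad₁ σ ∨ bad₂ σ ∨ bad₃ σ) → ∀ α : ℝ, 1 ≤ α → ∀ S : Fin n → Fin m,
      IsNearOptimal α (sketch (signMatrix σ) x) S →
        kmeansCost x S ≤ α * ((2 + ε) * kmeansCost x Sopt) := by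
    intro σ hσ α hα S hS
    simp only [hbad₁, hbad₂, hbad₃, not_or, not_not, not_lt] at hσ
    obtain ⟨g₁, g₂, g₃⟩ := hσ
    rw [sketch_signMatrix] at hS
    have hδ32 : 32 * (ε / 384) = ε / 12 := by ring
    rw [hδ32] at g₁
    refine kmeansCost_le_of_sketch (signMap σ) x Sopt S U e
      (fun j => Submodule.subset_span ⟨j, rfl⟩) hα hε hε' g₁ g₂ ?_ (hS.2 Sopt hSopt)
    rw [kmeansCost_map]
    simp only [distortion, Finset.sum_sub_distrib] at g₃
    rw [kmeansCost, ← hδ]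
    linarith
  have hcompl := Finset.card_filter_add_card_filter_not (s := Finset.univ)
    (fun σ => bad₁ σ ∨ bad₂ σ ∨ bad₃ σ)
  have hbadcard : (Finset.univ.filter fun σ => bad₁ σ ∨ bad₂ σ ∨ bad₃ σ).card
      ≤ (Finset.univ.filter bad₁).card + ((Finset.univ.filter bad₂).card
        + (Finset.univ.filter bad₃).card) := by
    rw [Finset.filter_or, Finset.filter_or]
    exact (Finset.card_union_le _ _).trans (Nat.add_le_add_left (Finset.card_union_le _ _) _)
  have hsub := Finset.card_le_card (Finset.monotone_filter_right Finset.univ fun σ _ => hgood σ)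
  rw [Finset.card_univ] at hcompl
  have hcompl' := congrArg (Nat.cast (R := ℝ)) hcompl
  rw [card_signs] at hcompl'
  push_cast at hcompl'
  have hbadcard' : ((Finset.univ.filter fun σ => bad₁ σ ∨ bad₂ σ ∨ bad₃ σ).card : ℝ)
      ≤ (Finset.univ.filter bad₁).card + ((Finset.univ.filter bad₂).card
        + (Finset.univ.filter bad₃).card) := by exact_mod_cast hbadcard
  refine le_trans ?_ (Nat.cast_le.mpr hsub)
  linarith

end Sketch

section Transfer

variable {Ω : Type*} [MeasurableSpace Ω] {μ : Measure Ω} {p q : ℕ}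
  {H : Ω → Matrix (Fin q) (Fin p) ℝ}

theorem IsRandomSignMatrix.measurableSet_eq (hH : IsRandomSignMatrix μ H)
    (σ : Fin q → Fin p → Bool) : MeasurableSet {ω | H ω = signMatrix σ} := by
  have : {ω | H ω = signMatrix σ} = ⋂ i, ⋂ j, (fun ω => H ω i j) ⁻¹' {signMatrix σ i j} := by
    ext ω
    simp [← Matrix.ext_iff]
  rw [this]
  exact MeasurableSet.iInter fun i => MeasurableSet.iInter fun j =>
    hH.measurable_entry i j (measurableSet_singleton _)

theorem IsRandomSignMatrix.measureReal_eq (hH : IsRandomSignMatrix μ H)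
    (σ : Fin q → Fin p → Bool) : μ.real {ω | H ω = signMatrix σ} = (numSigns p q)⁻¹ := by
  have hset : {ω | H ω = signMatrix σ} = ⋂ e ∈ (Finset.univ : Finset (Fin q × Fin p)),
      (fun ω => H ω e.1 e.2) ⁻¹' {signMatrix σ e.1 e.2} := by
    ext ω
    simp [← Matrix.ext_iff]
  have hentry : ∀ e : Fin q × Fin p,
      μ ((fun ω => H ω e.1 e.2) ⁻¹' {signMatrix σ e.1 e.2}) = 1 / 2 := by
    intro e
    cases hσ : σ e.1 e.2
    · have := hH.prob_neg e.1 e.2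
      simpa [signMatrix, boolSign, hσ, Set.preimage, Set.mem_singleton_iff] using this
    · have := hH.prob_pos e.1 e.2
      simpa [signMatrix, boolSign, hσ, Set.preimage, Set.mem_singleton_iff] using this
  rw [measureReal_def, hset, hH.indep.measure_inter_preimage_eq_mul Finset.univ
    (fun e _ => measurableSet_singleton _), Finset.prod_congr rfl fun e _ => hentry e]
  simp [numSigns, ← pow_mul, mul_comm]

theorem signMatrix_injective : Function.Injective (signMatrix (q := q) (p := p)) := by
  intro σ τ h
  funext i j
  have hq : (0 : ℝ) < 1 / √(q : ℝ) := by
    have : (0 : ℝ) < q := by exact_mod_cast Fin.pos i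
    positivity
  have hij := congrFun (congrFun h i) j
  simp only [signMatrix, Matrix.of_apply] at hij
  have := mul_right_cancel₀ hq.ne' hij
  cases h1 : σ i j <;> cases h2 : τ i j <;> simp [boolSign, h1, h2] at this ⊢ <;> linarith

/-- The law of a random sign matrix is the uniform distribution on sign patterns. -/
theorem IsRandomSignMatrix.card_div_le_measureReal [IsProbabilityMeasure μ]
    (hH : IsRandomSignMatrix μ H)
    (G : (Fin q → Fin p → Bool) → Prop) [DecidablePred G] {A : Set Ω}
    (hA : ∀ σ, G σ → ∀ ω, H ω = signMatrix σ → ω ∈ A) :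
    ((Finset.univ.filter G).card : ℝ) / numSigns p q ≤ μ.real A := by
  have hsub : (⋃ σ ∈ Finset.univ.filter G, {ω | H ω = signMatrix σ}) ⊆ A := by
    intro ω hω
    simp only [Set.mem_iUnion] at hω
    obtain ⟨σ, hσ, hω⟩ := hω
    exact hA σ (Finset.mem_filter.mp hσ).2 ω hω
  refine le_trans (le_of_eq ?_) (measureReal_mono hsub)
  rw [measureReal_biUnion_finset, Finset.sum_congr rfl fun σ _ => hH.measureReal_eq σ,
    Finset.sum_const, nsmul_eq_mul, div_eq_mul_inv]
  · intro σ _ τ _ hne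
    refine Set.disjoint_left.mpr fun ω h1 h2 => hne (signMatrix_injective ?_)
    exact (Eq.symm h1).trans h2
  · exact fun σ _ => hH.measurableSet_eq σ

end Transfer

end ClusteredNystrom

open ClusteredNystrom in
theorem mainTheorem1 :
    -- `c` is the absolute constant in the sketch dimension `p' = O(m / ε²)`
    ∃ c : ℝ, 0 < c ∧
    -- `η₁` and `η₂` depend only on `η`, on the approximation factor `α` and on `n`
    ∀ (η α : ℝ) (n : ℕ), 1 ≤ α →
    ∃ η₁ η₂ : ℝ, 0 < η₁ ∧ 0 < η₂ ∧
    ∀ (p m : ℕ) (κ : EuclideanSpace ℝ (Fin p) → EuclideanSpace ℝ (Fin p) → ℝ)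
      (hκ : IsKernel κ), KernelLipschitz κ η →
    ∀ (X : Fin n → EuclideanSpace ℝ (Fin p)) (Sopt : Fin n → Fin m), IsOptimal X Sopt →
    ∀ (ε : ℝ), 0 < ε → ε < 1 / 3 →
    ∀ (p' : ℕ), c * m / ε ^ 2 ≤ p' →
    ∀ (Ω : Type*) [MeasurableSpace Ω] (μ : Measure Ω) [IsProbabilityMeasure μ]
      (H : Ω → Matrix (Fin p') (Fin p) ℝ), IsRandomSignMatrix μ H →
    0.96 ≤ μ.real {ω | ∀ S : Fin n → Fin m, IsNearOptimal α (sketch (H ω) X) S →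
      kmeansCost X S ≤ α * ((2 + ε) * kmeansCost X Sopt) ∧
      nystromError κ hκ X (clusterMean X S)
        ≤ η₁ * √((2 + ε) * kmeansCost X Sopt) + η₂ * ((2 + ε) * kmeansCost X Sopt)} := by
  classical
  refine ⟨2 * 10 ^ 7, by norm_num, fun η α n hα =>
    ⟨2 * √(n * |η|) * √α + 1, 1, by positivity, one_pos, ?_⟩⟩
  intro p m κ hκ hη X Sopt hSopt ε hε hε' q hq Ω _ μ _ H hH
  have hnys : ∀ S : Fin n → Fin m, kmeansCost X S ≤ α * ((2 + ε) * kmeansCost X Sopt) →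
      nystromError κ hκ X (clusterMean X S) ≤ (2 * √(n * |η|) * √α + 1)
        * √((2 + ε) * kmeansCost X Sopt) + 1 * ((2 + ε) * kmeansCost X Sopt) := by
    intro S hS
    have h0 : 0 ≤ (2 + ε) * kmeansCost X Sopt := by unfold kmeansCost; positivity
    calc nystromError κ hκ X (clusterMean X S)
        ≤ 2 * √(n * |η|) * √(kmeansCost X S) := nystromError_le_sqrt hκ hη X _ S
      _ ≤ 2 * √(n * |η|) * √(α * ((2 + ε) * kmeansCost X Sopt)) := by gcongr
      _ = 2 * √(n * |η|) * √α * √((2 + ε) * kmeansCost X Sopt) := by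
          rw [Real.sqrt_mul (x := α) (by linarith), ← mul_assoc]
      _ ≤ _ := by
          have := Real.sqrt_nonneg ((2 + ε) * kmeansCost X Sopt)
          linarith
  have hN := numSigns_pos (p := p) (q := q)
  rcases Nat.eq_zero_or_pos m with rfl | hm
  · have hn : n = 0 := by
      by_contra hn
      exact (Sopt ⟨0, Nat.pos_of_ne_zero hn⟩).elim0
    subst hn
    have huniv : {ω | ∀ S : Fin 0 → Fin 0, IsNearOptimal α (sketch (H ω) X) S →
        kmeansCost X S ≤ α * ((2 + ε) * kmeansCost X Sopt) ∧
        nystromError κ hκ X (clusterMean X S) ≤ (2 * √((0 : ℕ) * |η|) * √α + 1)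
          * √((2 + ε) * kmeansCost X Sopt) + 1 * ((2 + ε) * kmeansCost X Sopt)} = Set.univ := by
      refine Set.eq_univ_of_forall fun ω S _ => ?_
      have hS : kmeansCost X S ≤ α * ((2 + ε) * kmeansCost X Sopt) := by simp [kmeansCost]
      exact ⟨hS, hnys S hS⟩
    rw [huniv, probReal_univ]
    norm_num
  · have hcard := card_good_signs_ge hm X Sopt hSopt.1 hε hε' hq
    rw [mul_comm, ← le_div_iff₀ hN] at hcard
    refine hcard.trans (hH.card_div_le_measureReal _ fun σ hσ ω hω S hS => ?_)
    rw [hω] at hS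
    have hcost := hσ α hα S hS
    exact ⟨hcost, hnys S hcost⟩
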